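/- Let $K$ be a compact Hausdorff space and $T : K \to K$ a homeomorphism. Let $M(K)$ be the space of regular Borel probability measures on $K$ with the weak$^*$ topology, i.e. the coarsest topology for which $\mu \mapsto \int_K f\,d\mu$ is continuous for every $f \in C(K)$, and let $S_T : M(K) \to M(K)$, $S_T(\mu) = T_*\mu = \mu\circ T^{-1}$, be the homeomorphism induced by $T$. For a homeomorphism $R$ of a compact Hausdorff space $X$, let $$h_{\mathrm{top}}(R) = \sup_{\mathcal W} \lim_{n\to\infty} \frac1n \log N\bigl(\mathcal W \vee R^{-1}\mathcal W \vee \cdots \vee R^{-(n-1)}\mathcal W\bigr) \in [0,\infty]$$ be its topological entropy, where the supremum is over all finite open covers $\mathcal W$ of $X$, $\mathcal{W}\vee\mathcal{V}=\{U\cap V : U\in\mathcal W,\ V\in\mathcal V\}$, $N(\cdot)$ denotes the smallest cardinality of a subcover, and $\log 0 := 0$ (relevant only if $X=\emptyset$). Then $h_{\mathrm{top}}(T) = 0$ if and only if $h_{\mathrm{top}}(S_T) = 0$. -/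

import Mathlib

open MeasureTheory

/-- `𝒲` is a finite open cover of `X`. -/
structure IsFiniteOpenCover {X : Type*} [TopologicalSpace X] (𝒲 : Set (Set X)) : Prop where
  finite : 𝒲.Finite
  isOpen : ∀ U ∈ 𝒲, IsOpen U
  sUnion_eq : ⋃₀ 𝒲 = Set.univ

/-- `N(𝒞)`: the smallest cardinality of a (finite) subcover of the cover `𝒞` of `X`. -/
noncomputable def minSubcoverCard {X : Type*} (𝒞 : Set (Set X)) : ℕ :=
  sInf {m : ℕ | ∃ F : Finset (Set X), (F : Set (Set X)) ⊆ 𝒞 ∧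
    ⋃₀ (F : Set (Set X)) = Set.univ ∧ F.card = m}

/-- The join `𝒲 ∨ T⁻¹𝒲 ∨ ⋯ ∨ T^{-(n-1)}𝒲`, whose members are the intersections
`A₀ ∩ T⁻¹A₁ ∩ ⋯ ∩ T^{-(n-1)}A_{n-1}` with all `A_k ∈ 𝒲`. -/
def iteratedJoin {X : Type*} (T : X → X) (𝒲 : Set (Set X)) (n : ℕ) : Set (Set X) :=
  {B | ∃ A : Fin n → Set X, (∀ k, A k ∈ 𝒲) ∧ B = ⋂ k : Fin n, T^[k] ⁻¹' A k}

/-- The entropy of `T` relative to the finite open cover `𝒲`: the limit of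
`(1/n) log N(𝒲 ∨ T⁻¹𝒲 ∨ ⋯ ∨ T^{-(n-1)}𝒲)` as `n → ∞`. The limit exists
(see `tendsto_openCoverEntropy`), so it is written as an upper limit. -/
noncomputable def openCoverEntropy {X : Type*} (T : X → X) (𝒲 : Set (Set X)) : EReal :=
  Filter.limsup
    (fun n : ℕ => ((Real.log (minSubcoverCard (iteratedJoin T 𝒲 n) : ℝ) / (n : ℝ) : ℝ) : EReal))
    Filter.atTop

/-- The topological entropy of `T` (Adler–Konheim–McAndrew): the supremum over all
finite open covers, a value in `[0, ∞]`. -/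
noncomputable def topologicalEntropy {X : Type*} [TopologicalSpace X] (T : X → X) : EReal :=
  ⨆ (𝒲 : Set (Set X)) (_ : IsFiniteOpenCover 𝒲), openCoverEntropy T 𝒲

theorem exists_minSubcover_iteratedJoin {X : Type*} [TopologicalSpace X] (T : X → X)
    {𝒲 : Set (Set X)} (h : IsFiniteOpenCover 𝒲) (n : ℕ) :
    ∃ F : Finset (Set X), (F : Set (Set X)) ⊆ iteratedJoin T 𝒲 n ∧
      ⋃₀ (F : Set (Set X)) = Set.univ ∧ F.card = minSubcoverCard (iteratedJoin T 𝒲 n) := by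
  apply Nat.sInf_mem (s := {m : ℕ | ∃ F : Finset (Set X),
    (F : Set (Set X)) ⊆ iteratedJoin T 𝒲 n ∧ ⋃₀ (F : Set (Set X)) = Set.univ ∧ F.card = m})
  have hfin : (iteratedJoin T 𝒲 n).Finite := by
    have : (Set.pi Set.univ (fun _ : Fin n => 𝒲)).Finite :=
      Set.Finite.pi fun _ => h.finite
    refine (this.image (fun A => ⋂ k : Fin n, T^[k] ⁻¹' A k)).subset ?_
    rintro B ⟨A, hA, rfl⟩
    exact ⟨A, fun k _ => hA k, rfl⟩
  refine ⟨_, hfin.toFinset, by simp, ?_, rfl⟩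
  rw [Set.Finite.coe_toFinset, Set.eq_univ_iff_forall]
  intro x
  have hx : ∀ y : X, ∃ U ∈ 𝒲, y ∈ U := fun y => by
    have : y ∈ ⋃₀ 𝒲 := h.sUnion_eq ▸ Set.mem_univ y
    exact this
  choose U hU hxU using hx
  exact ⟨_, ⟨fun k => U (T^[k] x), fun k => hU _, rfl⟩, Set.mem_iInter.2 fun k => hxU _⟩

theorem minSubcoverCard_iteratedJoin_add_le {X : Type*} [TopologicalSpace X] (T : X → X)
    {𝒲 : Set (Set X)} (h : IsFiniteOpenCover 𝒲) (m n : ℕ) :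
    minSubcoverCard (iteratedJoin T 𝒲 (m + n)) ≤
      minSubcoverCard (iteratedJoin T 𝒲 m) * minSubcoverCard (iteratedJoin T 𝒲 n) := by
  classical
  obtain ⟨F, hF, hFu, hFc⟩ := exists_minSubcover_iteratedJoin T h m
  obtain ⟨G, hG, hGu, hGc⟩ := exists_minSubcover_iteratedJoin T h n
  rw [← hFc, ← hGc]
  refine le_trans (Nat.sInf_le ⟨Finset.image₂ (fun A B => A ∩ T^[m] ⁻¹' B) F G, ?_, ?_, rfl⟩)
    (Finset.card_image₂_le _ _ _)
  · intro C hC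
    obtain ⟨A, hA, B, hB, rfl⟩ := Finset.mem_image₂.1 (Finset.mem_coe.1 hC)
    obtain ⟨a, ha, rfl⟩ := hF hA
    obtain ⟨b, hb, rfl⟩ := hG hB
    refine ⟨Fin.append a b, fun k => ?_, ?_⟩
    · induction k using Fin.addCases with
      | left i => simpa using ha i
      | right i => simpa using hb i
    · ext x
      simp only [Set.mem_inter_iff, Set.mem_iInter, Set.mem_preimage]
      constructor
      · rintro ⟨h1, h2⟩ k
        induction k using Fin.addCases with
        | left i => simpa using h1 i
        | right i => simpa [add_comm m, Function.iterate_add_apply] using h2 i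
      · intro h
        refine ⟨fun i => by simpa using h (Fin.castAdd n i), fun i => ?_⟩
        simpa [add_comm m, Function.iterate_add_apply] using h (Fin.natAdd m i)
  · rw [Set.eq_univ_iff_forall]
    intro x
    obtain ⟨A, hA, hxA⟩ : x ∈ ⋃₀ (F : Set (Set X)) := hFu ▸ Set.mem_univ x
    obtain ⟨B, hB, hxB⟩ : T^[m] x ∈ ⋃₀ (G : Set (Set X)) := hGu ▸ Set.mem_univ _
    exact ⟨_, Finset.mem_coe.2 (Finset.mem_image₂_of_mem hA hB), hxA, hxB⟩

/-- The upper limit in the definition of `openCoverEntropy` is a limit. -/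
theorem tendsto_openCoverEntropy {X : Type*} [TopologicalSpace X] (T : X → X)
    {𝒲 : Set (Set X)} (h : IsFiniteOpenCover 𝒲) :
    Filter.Tendsto
      (fun n : ℕ => ((Real.log (minSubcoverCard (iteratedJoin T 𝒲 n) : ℝ) / (n : ℝ) : ℝ) : EReal))
      Filter.atTop (nhds (openCoverEntropy T 𝒲)) := by
  have hsub : Subadditive
      (fun n : ℕ => Real.log (minSubcoverCard (iteratedJoin T 𝒲 n) : ℝ)) := by
    intro m n
    have hle := minSubcoverCard_iteratedJoin_add_le T h m n
    rcases Nat.eq_zero_or_pos (minSubcoverCard (iteratedJoin T 𝒲 (m + n))) with h0 | hpos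
    · simp only [h0, Nat.cast_zero, Real.log_zero]
      exact add_nonneg (Real.log_natCast_nonneg _) (Real.log_natCast_nonneg _)
    · have hm : minSubcoverCard (iteratedJoin T 𝒲 m) ≠ 0 := by
        intro h0; rw [h0] at hle; omega
      have hn : minSubcoverCard (iteratedJoin T 𝒲 n) ≠ 0 := by
        intro h0; rw [h0] at hle; omega
      rw [← Real.log_mul (by exact_mod_cast hm) (by exact_mod_cast hn)]
      exact Real.log_le_log (by exact_mod_cast hpos) (by exact_mod_cast hle)
  have hlim := hsub.tendsto_lim ⟨0, by
    rintro _ ⟨n, rfl⟩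
    exact div_nonneg (Real.log_natCast_nonneg _) (Nat.cast_nonneg _)⟩
  have hlim' := (continuous_coe_real_ereal.tendsto _).comp hlim
  have heq : openCoverEntropy T 𝒲 = (hsub.lim : EReal) := Filter.Tendsto.limsup_eq hlim'
  rw [heq]
  exact hlim'

/-- The space of (regular Borel) probability measures on `K`, with the weak* topology, that is,
the coarsest topology making `μ ↦ ∫ f ∂μ` continuous for every bounded continuous `f`. It
carries the subspace topology from `MeasureTheory.ProbabilityMeasure K`. For compact
metrizable `K` every Borel probability measure is regular. -/
abbrev RegularProbabilityMeasure (K : Type*) [TopologicalSpace K] [MeasurableSpace K]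
    [BorelSpace K] : Type _ :=
  {μ : ProbabilityMeasure K // (μ : Measure K).Regular}

/-- The push-forward `μ ↦ T_* μ` of regular probability measures by a homeomorphism. -/
noncomputable def RegularProbabilityMeasure.map {K : Type*} [TopologicalSpace K]
    [MeasurableSpace K] [BorelSpace K] (T : K ≃ₜ K) (μ : RegularProbabilityMeasure K) :
    RegularProbabilityMeasure K :=
  ⟨μ.1.map T.continuous.measurable.aemeasurable, by
    have := μ.2
    exact Measure.Regular.map T⟩

theorem RegularProbabilityMeasure.continuous_map {K : Type*} [TopologicalSpace K]
    [MeasurableSpace K] [BorelSpace K] (T : K ≃ₜ K) :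
    Continuous (RegularProbabilityMeasure.map T) :=
  ((ProbabilityMeasure.continuous_map T.continuous).comp continuous_subtype_val).subtype_mk _

theorem RegularProbabilityMeasure.map_symm_map {K : Type*} [TopologicalSpace K]
    [MeasurableSpace K] [BorelSpace K] (T : K ≃ₜ K) (μ : RegularProbabilityMeasure K) :
    RegularProbabilityMeasure.map T.symm (RegularProbabilityMeasure.map T μ) = μ := by
  apply Subtype.ext
  apply Subtype.ext
  change Measure.map T.symm (Measure.map T (μ.1 : Measure K)) = (μ.1 : Measure K)
  rw [Measure.map_map T.symm.continuous.measurable T.continuous.measurable]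
  simp

/-- The homeomorphism `S_T : μ ↦ T_* μ` induced by `T` on the space of probability measures. -/
noncomputable def inducedHomeomorph {K : Type*} [TopologicalSpace K] [MeasurableSpace K]
    [BorelSpace K] (T : K ≃ₜ K) :
    RegularProbabilityMeasure K ≃ₜ RegularProbabilityMeasure K where
  toFun := RegularProbabilityMeasure.map T
  invFun := RegularProbabilityMeasure.map T.symm
  left_inv := RegularProbabilityMeasure.map_symm_map T
  right_inv := RegularProbabilityMeasure.map_symm_map T.symm
  continuous_toFun := RegularProbabilityMeasure.continuous_map T
  continuous_invFun := RegularProbabilityMeasure.continuous_map T.symm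

open Topology BoundedContinuousFunction

/-! Zero entropy means that `N` grows subexponentially in `n` for every cover. Metrizability is not
assumed, so finitely many real coordinates serve as a metric: values `f x` on `K`, integrals `∫ f
∂μ` on measures. Bounding `N` then means coding points by a finite set so that equal codes force
close coordinates along `n` iterates.

From measures to `K`, restrict to Dirac masses.

From `K` to measures, fix `r` independently of `n`. A variance bound (`exists_sample_card_bad_le`)
yields `r` points whose averages of `f ∘ T^k`, `k < n`, are accurate for all but a small proportion
of the pairs `(k, f)`. The code of `μ` records the cells of an `n`-step join on `K` containing these
points, together with rounded integrals at the bad pairs. There are `N ^ r` cell choices,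
subexponentially many, and sparse corrections contribute an arbitrarily small exponential rate
(`card_option_valued_le`). -/

/-! ### Covers and finitely many coordinates -/

/-- Lebesgue number lemma, with finitely many coordinates in place of a metric. -/
theorem exists_finset_ball_subset_of_isInducing {X I : Type*} [TopologicalSpace X] [CompactSpace X]
    {φ : X → I → ℝ} (hφ : IsInducing φ) {𝒲 : Set (Set X)} (h : IsFiniteOpenCover 𝒲) :
    ∃ (s : Finset I) (η : ℝ), 0 < η ∧
      ∀ x, ∃ U ∈ 𝒲, ∀ y, (∀ i ∈ s, |φ y i - φ x i| < η) → y ∈ U := by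
  classical
  -- The doubled radius leaves room for the triangle inequality through a centre of the finite
  -- subcover.
  have loc : ∀ x : X, ∃ (s : Finset I) (η : ℝ), 0 < η ∧
      ∃ U ∈ 𝒲, ∀ y, (∀ i ∈ s, |φ y i - φ x i| < η + η) → y ∈ U := by
    intro x
    obtain ⟨U, hU, hxU⟩ : x ∈ ⋃₀ 𝒲 := h.sUnion_eq ▸ Set.mem_univ x
    have hn : U ∈ 𝓝 x := (h.isOpen U hU).mem_nhds hxU
    rw [hφ.nhds_eq_comap, nhds_pi] at hn
    obtain ⟨V, hV, hVU⟩ := hn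
    obtain ⟨A, hA, t, ht, htV⟩ := Filter.mem_pi.1 hV
    choose ε hε hεt using fun i => Metric.mem_nhds_iff.1 (ht i)
    obtain ⟨ρ, hρ, hρε⟩ : ∃ ρ : ℝ, 0 < ρ ∧ ∀ i ∈ hA.toFinset, ρ ≤ ε i := by
      rcases hA.toFinset.eq_empty_or_nonempty with h0 | h0
      · exact ⟨1, one_pos, by simp [h0]⟩
      · exact ⟨hA.toFinset.inf' h0 ε, (Finset.lt_inf'_iff _).2 fun i _ => hε i,
          fun i hi => Finset.inf'_le _ hi⟩
    refine ⟨hA.toFinset, ρ / 2, by positivity, U, hU, fun y hy => hVU (htV fun i hi => hεt i ?_)⟩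
    rw [Metric.mem_ball, Real.dist_eq]
    have h1 := hy i (by simpa using hi)
    have h2 := hρε i (by simpa using hi)
    linarith
  choose s η hη U hU hsub using loc
  have hφc := hφ.continuous
  have hopen : ∀ x, {y | ∀ i ∈ s x, |φ y i - φ x i| < η x} ∈ 𝓝 x := by
    intro x
    refine (Filter.eventually_all_finset (s x)).2 fun i _ => ?_
    have hc : Continuous fun y => |φ y i - φ x i| :=
      (((continuous_apply i).comp hφc).sub continuous_const).abs
    exact hc.continuousAt.eventually_lt continuousAt_const (by simpa using hη x)
  obtain ⟨t, ht⟩ := CompactSpace.elim_nhds_subcover _ hopen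
  obtain ⟨ρ, hρ, hρη⟩ : ∃ ρ : ℝ, 0 < ρ ∧ ∀ x ∈ t, ρ ≤ η x := by
    rcases t.eq_empty_or_nonempty with h0 | h0
    · exact ⟨1, one_pos, by simp [h0]⟩
    · exact ⟨t.inf' h0 η, (Finset.lt_inf'_iff _).2 fun i _ => hη i, fun i hi => Finset.inf'_le _ hi⟩
  refine ⟨t.biUnion s, ρ, hρ, fun x => ?_⟩
  have hx : x ∈ ⋃ z ∈ t, {y | ∀ i ∈ s z, |φ y i - φ z i| < η z} := by
    rw [ht]; trivial
  simp only [Set.mem_iUnion] at hx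
  obtain ⟨z, hz, hxz⟩ := hx
  refine ⟨U z, hU z, fun y hy => hsub z y fun i hi => ?_⟩
  have h1 := hy i (Finset.mem_biUnion.2 ⟨z, hz, hi⟩)
  have h2 := hxz i hi
  have h3 := hρη z hz
  have h4 := abs_sub_le (φ y i) (φ x i) (φ z i)
  linarith

theorem exists_isFiniteOpenCover_forall_abs_sub_lt {X I : Type*} [TopologicalSpace X]
    [CompactSpace X] {φ : X → I → ℝ} (hφ : Continuous φ) (s : Finset I) {η : ℝ} (hη : 0 < η) :
    ∃ 𝒲 : Set (Set X), IsFiniteOpenCover 𝒲 ∧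
      ∀ U ∈ 𝒲, ∀ x ∈ U, ∀ y ∈ U, ∀ i ∈ s, |φ x i - φ y i| < η := by
  let V : X → Set X := fun z => {y | ∀ i ∈ s, |φ y i - φ z i| < η / 2}
  have hV : ∀ z, IsOpen (V z) := by
    intro z
    have : V z = ⋂ i ∈ s, {y | |φ y i - φ z i| < η / 2} := by
      ext y; simp [V]
    rw [this]
    refine isOpen_biInter_finset fun i _ => isOpen_lt ?_ continuous_const
    exact (((continuous_apply i).comp hφ).sub continuous_const).abs
  have hzV : ∀ z, z ∈ V z := fun z i _ => by simpa using hη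
  obtain ⟨t, ht⟩ := CompactSpace.elim_nhds_subcover V fun z => (hV z).mem_nhds (hzV z)
  refine ⟨V '' t, ⟨t.finite_toSet.image V, ?_, ?_⟩, ?_⟩
  · rintro _ ⟨z, _, rfl⟩
    exact hV z
  · rw [Set.sUnion_image]
    exact ht
  · rintro _ ⟨z, _, rfl⟩ x hx y hy i hi
    have h1 := hx i hi
    have h2 := hy i hi
    rw [abs_sub_comm] at h2
    have h4 := abs_sub_le (φ x i) (φ z i) (φ y i)
    linarith

/-! ### Bounding `N` by codes -/

theorem minSubcoverCard_le_card {X α : Type*} [Fintype α] {𝒞 : Set (Set X)} (code : X → α)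
    (h : ∀ x, ∃ B ∈ 𝒞, ∀ y, code y = code x → y ∈ B) :
    minSubcoverCard 𝒞 ≤ Fintype.card α := by
  classical
  choose B hB hcode using h
  -- One member of the cover per attained code; the value `∅` is never used.
  let g : α → Set X := fun a => if h : ∃ x, code x = a then B h.choose else ∅
  have hg : ∀ x, ∃ z, g (code x) = B z ∧ code x = code z := fun x => by
    have hx : ∃ z, code z = code x := ⟨x, rfl⟩
    exact ⟨hx.choose, dif_pos hx, hx.choose_spec.symm⟩
  have hfin : (Set.range code).Finite := Set.toFinite _
  refine le_trans (Nat.sInf_le ⟨hfin.toFinset.image g, ?_, ?_, rfl⟩)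
    (Finset.card_image_le.trans (Finset.card_le_univ _))
  · intro C hC
    simp only [Finset.coe_image, Set.Finite.coe_toFinset, Set.mem_image, Set.mem_range] at hC
    obtain ⟨_, ⟨x, rfl⟩, rfl⟩ := hC
    obtain ⟨z, hz, _⟩ := hg x
    rw [hz]
    exact hB z
  · refine Set.eq_univ_iff_forall.2 fun x => ?_
    obtain ⟨z, hz, hxz⟩ := hg x
    refine ⟨g (code x), by simp, ?_⟩
    rw [hz]
    exact hcode z x hxz

theorem minSubcoverCard_iteratedJoin_le_card {X I α : Type*} [Fintype α] {T : X → X}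
    {𝒲 : Set (Set X)} {φ : X → I → ℝ} {s : Finset I} {η : ℝ}
    (hball : ∀ x, ∃ U ∈ 𝒲, ∀ y, (∀ i ∈ s, |φ y i - φ x i| < η) → y ∈ U) (n : ℕ) (code : X → α)
    (h : ∀ x y, code y = code x →
      ∀ k : Fin n, ∀ i ∈ s, |φ (T^[k] y) i - φ (T^[k] x) i| < η) :
    minSubcoverCard (iteratedJoin T 𝒲 n) ≤ Fintype.card α := by
  choose U hU hsub using hball
  refine minSubcoverCard_le_card code fun x => ⟨⋂ k : Fin n, T^[k] ⁻¹' U (T^[k] x),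
    ⟨fun k => U (T^[k] x), fun k => hU _, rfl⟩, fun y hy => Set.mem_iInter.2 fun k => ?_⟩
  exact hsub _ _ (h x y hy k)

/-! ### Zero entropy as subexponential growth -/

theorem openCoverEntropy_nonneg {X : Type*} [TopologicalSpace X] (T : X → X) {𝒲 : Set (Set X)}
    (h : IsFiniteOpenCover 𝒲) : 0 ≤ openCoverEntropy T 𝒲 := by
  refine ge_of_tendsto' (tendsto_openCoverEntropy T h) fun n => ?_
  exact_mod_cast div_nonneg (Real.log_natCast_nonneg _) (Nat.cast_nonneg _)

theorem openCoverEntropy_eq_zero_iff {X : Type*} [TopologicalSpace X] (T : X → X)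
    {𝒲 : Set (Set X)} (h : IsFiniteOpenCover 𝒲) :
    openCoverEntropy T 𝒲 = 0 ↔ ∀ γ : ℝ, 0 < γ → ∀ᶠ n : ℕ in Filter.atTop,
      (minSubcoverCard (iteratedJoin T 𝒲 n) : ℝ) ≤ Real.exp (γ * n) := by
  have hlim := tendsto_openCoverEntropy T h
  constructor
  · intro h0 γ hγ
    rw [h0] at hlim
    have hev := hlim.eventually (gt_mem_nhds (show (0 : EReal) < (γ : EReal) by exact_mod_cast hγ))
    filter_upwards [hev, Filter.eventually_gt_atTop 0] with n hn hn0
    have hn0' : (0 : ℝ) < n := by exact_mod_cast hn0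
    have hn' : Real.log (minSubcoverCard (iteratedJoin T 𝒲 n) : ℝ) / n < γ := by
      exact_mod_cast hn
    rw [div_lt_iff₀ hn0'] at hn'
    -- The count vanishes only when `X` is empty.
    rcases Nat.eq_zero_or_pos (minSubcoverCard (iteratedJoin T 𝒲 n)) with hz | hpos
    · rw [hz, Nat.cast_zero]
      positivity
    · rw [← Real.log_le_iff_le_exp (by exact_mod_cast hpos)]
      exact hn'.le
  · intro hγ
    refine le_antisymm (le_of_forall_gt fun c hc => ?_) (openCoverEntropy_nonneg T h)
    obtain ⟨γ, hγ0, hγc⟩ := EReal.lt_iff_exists_real_btwn.1 hc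
    refine lt_of_le_of_lt (le_of_tendsto hlim ?_) hγc
    have hγ0' : 0 < γ := by exact_mod_cast hγ0
    filter_upwards [hγ γ hγ0', Filter.eventually_gt_atTop 0] with n hn hn0
    have hn0' : (0 : ℝ) < n := by exact_mod_cast hn0
    have : Real.log (minSubcoverCard (iteratedJoin T 𝒲 n) : ℝ) / n ≤ γ := by
      rw [div_le_iff₀ hn0']
      rcases Nat.eq_zero_or_pos (minSubcoverCard (iteratedJoin T 𝒲 n)) with hz | hpos
      · rw [hz, Nat.cast_zero, Real.log_zero]
        positivity
      · rwa [Real.log_le_iff_le_exp (by exact_mod_cast hpos)]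
    exact_mod_cast this

theorem topologicalEntropy_eq_zero_iff {X : Type*} [TopologicalSpace X] (T : X → X) :
    topologicalEntropy T = 0 ↔ ∀ 𝒲 : Set (Set X), IsFiniteOpenCover 𝒲 → ∀ γ : ℝ, 0 < γ →
      ∀ᶠ n : ℕ in Filter.atTop,
        (minSubcoverCard (iteratedJoin T 𝒲 n) : ℝ) ≤ Real.exp (γ * n) := by
  -- The trivial cover shows that the supremum in `EReal` is nonnegative.
  have huniv : IsFiniteOpenCover ({Set.univ} : Set (Set X)) :=
    ⟨Set.finite_singleton _, by simp, by simp⟩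
  constructor
  · intro h0 𝒲 h
    refine (openCoverEntropy_eq_zero_iff T h).1 (le_antisymm ?_ (openCoverEntropy_nonneg T h))
    rw [← h0]
    exact le_iSup₂_of_le 𝒲 h le_rfl
  · intro h
    refine le_antisymm (iSup₂_le fun 𝒲 h𝒲 =>
      ((openCoverEntropy_eq_zero_iff T h𝒲).2 (h 𝒲 h𝒲)).le) ?_
    exact (openCoverEntropy_nonneg T huniv).trans (le_iSup₂_of_le _ huniv le_rfl)

/-! ### Counting sparse corrections -/

/-- Chernoff bound: give each entry other than `none` weight `exp (-τ)`. The total weight factors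
over `J`, and every counted function has weight at least `exp (-τ * D)`. -/
theorem card_option_valued_le {J G : Type*} [Fintype J] [DecidableEq J] [Fintype G] (τ D : ℝ)
    (hτ : 0 ≤ τ) :
    (Nat.card {c : J → Option G // (Nat.card {j // c j ≠ none} : ℝ) ≤ D} : ℝ) ≤
      Real.exp (τ * D + Fintype.card J * (Fintype.card G * Real.exp (-τ))) := by
  classical
  let w : Option G → ℝ := fun o => if o = none then 1 else Real.exp (-τ)
  have hw : ∀ c : J → Option G,
      ∏ j, w (c j) = Real.exp (-τ * (Nat.card {j // c j ≠ none} : ℝ)) := by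
    intro c
    simp only [w]
    rw [Finset.prod_ite, Finset.prod_const_one, one_mul, Finset.prod_const, Nat.card_eq_fintype_card,
      Fintype.card_subtype, ← Real.exp_nat_mul, mul_comm]
  have hsum : ∑ c : J → Option G, ∏ j, w (c j) =
      (1 + Fintype.card G * Real.exp (-τ)) ^ Fintype.card J := by
    have h1 : ∑ o : Option G, w o = 1 + Fintype.card G * Real.exp (-τ) := by
      simp [w, Fintype.sum_option]
    rw [← h1, ← Finset.card_univ, ← Finset.prod_const, Finset.prod_univ_sum]
    simp
  have hlow : (Nat.card {c : J → Option G // (Nat.card {j // c j ≠ none} : ℝ) ≤ D} : ℝ) *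
      Real.exp (-τ * D) ≤ ∑ c : J → Option G, ∏ j, w (c j) := by
    rw [Nat.card_eq_fintype_card, Fintype.card_subtype, ← nsmul_eq_mul, ← Finset.sum_const]
    refine (Finset.sum_le_sum fun c hc => ?_).trans (Finset.sum_le_sum_of_subset_of_nonneg
      (Finset.filter_subset _ _) fun c _ _ => ?_)
    · rw [hw]
      refine Real.exp_le_exp.2 ?_
      have := (Finset.mem_filter.1 hc).2
      nlinarith
    · rw [hw]
      positivity
  have hup : (1 + Fintype.card G * Real.exp (-τ)) ^ Fintype.card J ≤
      Real.exp (Fintype.card J * (Fintype.card G * Real.exp (-τ))) := by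
    rw [Real.exp_nat_mul]
    refine pow_le_pow_left₀ (by positivity) ?_ _
    rw [add_comm]
    exact Real.add_one_le_exp _
  rw [hsum] at hlow
  calc (Nat.card {c : J → Option G // (Nat.card {j // c j ≠ none} : ℝ) ≤ D} : ℝ)
      = Real.exp (τ * D) * ((Nat.card {c : J → Option G //
          (Nat.card {j // c j ≠ none} : ℝ) ≤ D} : ℝ) * Real.exp (-τ * D)) := by
        rw [mul_left_comm, ← Real.exp_add]; simp
    _ ≤ Real.exp (τ * D) * Real.exp (Fintype.card J * (Fintype.card G * Real.exp (-τ))) := by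
        gcongr
        exact hlow.trans hup
    _ = _ := by rw [← Real.exp_add]

/-! ### Sampling a measure by few points -/

/-- Averaged over `x`, the cross terms vanish and each variance is at most `M ^ 2`; some point does
no worse than the average. This adds one sample point in the induction below. -/
theorem exists_sum_sq_add_sub_integral_le {K J : Type*} [MeasurableSpace K] [Fintype J]
    (μ : Measure K) [IsProbabilityMeasure μ] {h : J → K → ℝ} {M : ℝ}
    (hm : ∀ j, AEStronglyMeasurable (h j) μ) (hM : ∀ j x, |h j x| ≤ M) (v : J → ℝ) :
    ∃ x, ∑ j, (v j + (h j x - ∫ y, h j y ∂μ)) ^ 2 ≤ ∑ j, v j ^ 2 + Fintype.card J * M ^ 2 := by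
  have hi : ∀ j, Integrable (h j) μ := fun j =>
    Integrable.of_bound (hm j) M (Filter.Eventually.of_forall fun x => hM j x)
  have hi2 : ∀ j, Integrable (fun x => h j x ^ 2) μ := fun j =>
    Integrable.of_bound ((hm j).pow 2) (M ^ 2) (Filter.Eventually.of_forall fun x => by
      rw [Real.norm_eq_abs, abs_pow]
      exact pow_le_pow_left₀ (abs_nonneg _) (hM j x) 2)
  have hsq : ∀ j, (fun x => (v j + (h j x - ∫ y, h j y ∂μ)) ^ 2) =
      fun x => h j x ^ 2 + (2 * (v j - ∫ y, h j y ∂μ)) * h j x + (v j - ∫ y, h j y ∂μ) ^ 2 :=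
    fun j => by funext x; ring
  have hint : ∀ j, Integrable (fun x => (v j + (h j x - ∫ y, h j y ∂μ)) ^ 2) μ := fun j => by
    rw [hsq]
    exact ((hi2 j).add ((hi j).const_mul _)).add (integrable_const _)
  obtain ⟨x, hx⟩ := exists_le_integral (μ := μ)
    (integrable_finsetSum Finset.univ fun j _ => hint j)
  refine ⟨x, hx.trans ?_⟩
  rw [integral_finsetSum _ fun j _ => hint j]
  have hb : ∀ j, ∫ x, (v j + (h j x - ∫ y, h j y ∂μ)) ^ 2 ∂μ ≤ v j ^ 2 + M ^ 2 := by
    intro j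
    have heq : ∫ x, (v j + (h j x - ∫ y, h j y ∂μ)) ^ 2 ∂μ = ∫ x, h j x ^ 2 ∂μ +
        (2 * (v j - ∫ y, h j y ∂μ)) * ∫ x, h j x ∂μ + (v j - ∫ y, h j y ∂μ) ^ 2 := by
      rw [hsq]
      refine (integral_add ((hi2 j).add ((hi j).const_mul _)) (integrable_const _)).trans ?_
      simp only [Pi.add_apply]
      rw [integral_add (hi2 j) ((hi j).const_mul _), integral_const_mul, integral_const]
      simp
    rw [heq]
    have h2 : ∫ x, h j x ^ 2 ∂μ ≤ M ^ 2 := by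
      calc ∫ x, h j x ^ 2 ∂μ ≤ ∫ _, M ^ 2 ∂μ := by
            refine integral_mono (hi2 j) (integrable_const _) fun x => ?_
            exact sq_le_sq' (abs_le.1 (hM j x)).1 (abs_le.1 (hM j x)).2
        _ = M ^ 2 := by simp
    -- With `m` the mean, the expression equals `∫ h² + v² - m²`.
    nlinarith [sq_nonneg (∫ y, h j y ∂μ)]
  calc ∑ j, ∫ x, (v j + (h j x - ∫ y, h j y ∂μ)) ^ 2 ∂μ ≤ ∑ j, (v j ^ 2 + M ^ 2) :=
        Finset.sum_le_sum fun j _ => hb j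
    _ = _ := by simp [Finset.sum_add_distrib]

/-- A derandomized law of large numbers: some `r` points give empirical sums whose total squared
deviation from the means is at most the bound on the total variance. -/
theorem exists_sample_sum_sq_le {K J : Type*} [MeasurableSpace K] [Fintype J]
    (μ : Measure K) [IsProbabilityMeasure μ] {h : J → K → ℝ} {M : ℝ}
    (hm : ∀ j, AEStronglyMeasurable (h j) μ) (hM : ∀ j x, |h j x| ≤ M) (r : ℕ) :
    ∃ x : Fin r → K, ∑ j, (∑ l, (h j (x l) - ∫ y, h j y ∂μ)) ^ 2 ≤
      r * (Fintype.card J * M ^ 2) := by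
  induction r with
  | zero => exact ⟨Fin.elim0, by simp⟩
  | succ r ih =>
    obtain ⟨x, hx⟩ := ih
    obtain ⟨z, hz⟩ := exists_sum_sq_add_sub_integral_le μ hm hM
      fun j => ∑ l, (h j (x l) - ∫ y, h j y ∂μ)
    refine ⟨Fin.snoc x z, ?_⟩
    simp only [Fin.sum_univ_castSucc, Fin.snoc_castSucc, Fin.snoc_last]
    push_cast
    linarith

/-- For all but a proportion `M ^ 2 / (r * ε ^ 2)` of the functions `h j`, the average over suitable
`r` points is within `ε` of the mean. -/
theorem exists_sample_card_bad_le {K J : Type*} [MeasurableSpace K] [Fintype J]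
    (μ : Measure K) [IsProbabilityMeasure μ] {h : J → K → ℝ} {M ε : ℝ} (hε : 0 < ε)
    (hm : ∀ j, AEStronglyMeasurable (h j) μ) (hM : ∀ j x, |h j x| ≤ M) {r : ℕ} (hr : 0 < r) :
    ∃ x : Fin r → K, (Nat.card {j // ε ≤ |(∑ l, h j (x l)) / r - ∫ y, h j y ∂μ|} : ℝ) ≤
      Fintype.card J * (M ^ 2 / (r * ε ^ 2)) := by
  classical
  obtain ⟨x, hx⟩ := exists_sample_sum_sq_le μ hm hM r
  refine ⟨x, ?_⟩
  have hr' : (0 : ℝ) < r := by exact_mod_cast hr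
  set B : Finset J := Finset.univ.filter
    fun j => ε ≤ |(∑ l, h j (x l)) / r - ∫ y, h j y ∂μ| with hB
  have hcard : Nat.card {j // ε ≤ |(∑ l, h j (x l)) / r - ∫ y, h j y ∂μ|} = B.card := by
    rw [Nat.card_eq_fintype_card, Fintype.card_subtype]
  have hlow : (B.card : ℝ) * (r * ε) ^ 2 ≤ r * (Fintype.card J * M ^ 2) := by
    refine le_trans ?_ hx
    rw [← nsmul_eq_mul, ← Finset.sum_const]
    refine (Finset.sum_le_sum fun j hj => ?_).trans (Finset.sum_le_sum_of_subset_of_nonneg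
      (Finset.filter_subset _ _) fun j _ _ => sq_nonneg _)
    have hj' := (Finset.mem_filter.1 hj).2
    have heq : ∑ l, (h j (x l) - ∫ y, h j y ∂μ) =
        r * ((∑ l, h j (x l)) / r - ∫ y, h j y ∂μ) := by
      rw [Finset.sum_sub_distrib]
      simp only [Finset.sum_const, Finset.card_univ, Fintype.card_fin, nsmul_eq_mul]
      field_simp
    rw [heq, ← sq_abs (_ * (_ - _)), abs_mul, abs_of_pos hr']
    exact pow_le_pow_left₀ (by positivity) (mul_le_mul_of_nonneg_left hj' hr'.le) 2
  rw [hcard, ← mul_div_assoc, le_div_iff₀ (by positivity)]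
  refine le_of_mul_le_mul_left ?_ hr'
  linarith

/-! ### The weak* topology, compactness and Dirac masses -/

theorem MeasureTheory.ProbabilityMeasure.isInducing_integral (K : Type*) [TopologicalSpace K] [MeasurableSpace K]
    [OpensMeasurableSpace K] :
    IsInducing fun (μ : ProbabilityMeasure K) (f : K →ᵇ ℝ) => ∫ x, f x ∂(μ : Measure K) := by
  refine isInducing_iff_nhds.2 fun μ => le_antisymm ?_ ?_
  · refine Filter.map_le_iff_le_comap.1 (Continuous.tendsto ?_ μ)
    exact _root_.continuous_pi fun f => ProbabilityMeasure.continuous_integral_boundedContinuousFunction f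
  · rw [← Filter.tendsto_id']
    refine ProbabilityMeasure.tendsto_iff_forall_integral_tendsto.2 fun f => ?_
    exact ((continuous_apply f).tendsto (fun g : K →ᵇ ℝ => ∫ x, g x ∂(μ : Measure K))).comp
      (Filter.tendsto_comap (f := fun (μ : ProbabilityMeasure K) (g : K →ᵇ ℝ) =>
        ∫ x, g x ∂(μ : Measure K)))

theorem RegularProbabilityMeasure.isInducing_integral (K : Type*) [TopologicalSpace K]
    [MeasurableSpace K] [BorelSpace K] :
    IsInducing fun (μ : RegularProbabilityMeasure K) (f : K →ᵇ ℝ) =>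
      ∫ x, f x ∂(μ.1 : Measure K) :=
  (ProbabilityMeasure.isInducing_integral K).comp IsInducing.subtypeVal

theorem isInducing_eval_boundedContinuousFunction (K : Type*) [TopologicalSpace K] [T0Space K]
    [CompletelyRegularSpace K] : IsInducing fun (x : K) (f : K →ᵇ ℝ) => f x := by
  borelize K
  convert (ProbabilityMeasure.isInducing_integral K).comp
    (isEmbedding_diracProba (X := K)).isInducing using 1
  funext x f
  exact (MeasureTheory.integral_dirac' _ _ f.continuous.stronglyMeasurable).symm

/-- Replacing a probability measure by the regular one with the same integrals is continuous, since
integrals induce the topology. It fixes regular measures, so it maps the compact space of all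
probability measures onto them. -/
instance RegularProbabilityMeasure.compactSpace (K : Type*) [TopologicalSpace K]
    [CompactSpace K] [T2Space K] [MeasurableSpace K] [BorelSpace K] :
    CompactSpace (RegularProbabilityMeasure K) := by
  have hex : ∀ μ : ProbabilityMeasure K, ∃ ν : RegularProbabilityMeasure K,
      ∀ f : K →ᵇ ℝ, ∫ x, f x ∂(μ : Measure K) = ∫ x, f x ∂(ν.1 : Measure K) := by
    intro μ
    obtain ⟨ν, hreg, hfin, hν⟩ := Measure.exists_regular_eq_of_compactSpace (μ : Measure K)
    -- Testing against the constant `1` gives `ν` total mass one.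
    have h1 := hν 1
    simp only [BoundedContinuousFunction.coe_one, Pi.one_apply, integral_const, probReal_univ,
      smul_eq_mul, mul_one] at h1
    have hprob : IsProbabilityMeasure ν := ⟨by
      rw [measureReal_def] at h1
      exact (ENNReal.toReal_eq_one_iff _).1 h1.symm⟩
    exact ⟨⟨⟨ν, hprob⟩, hreg⟩, hν⟩
  choose ρ hρ using hex
  have hcont : Continuous ρ := by
    rw [(RegularProbabilityMeasure.isInducing_integral K).continuous_iff]
    convert (ProbabilityMeasure.isInducing_integral K).continuous using 1
    funext μ f
    exact (hρ μ f).symm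
  refine Function.Surjective.compactSpace hcont fun ν => ⟨ν.1, ?_⟩
  apply Subtype.ext
  apply Subtype.ext
  have := ν.2
  have := (ρ ν.1).2
  refine Measure.ext_of_integral_eq_on_compactlySupported (μ := ((ρ ν.1).1 : Measure K))
    (ν := (ν.1 : Measure K)) fun f => ?_
  exact (hρ ν.1 (BoundedContinuousFunction.mkOfCompact f.toContinuousMap)).symm

theorem MeasureTheory.Measure.regular_dirac {K : Type*} [TopologicalSpace K] [T1Space K] [MeasurableSpace K]
    [BorelSpace K] (x : K) : (Measure.dirac x).Regular where
  lt_top_of_isCompact := fun _ _ => measure_lt_top _ _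
  outerRegular := fun A hA c hc => by
    by_cases hx : x ∈ A
    · exact ⟨Set.univ, Set.subset_univ _, isOpen_univ, by simpa [hA, hx] using hc⟩
    · refine ⟨{x}ᶜ, fun y hy => ?_, isOpen_compl_singleton, ?_⟩
      · rintro rfl
        exact hx hy
      · refine lt_of_le_of_lt ?_ hc
        simp
  innerRegular := fun U hU c hc => by
    by_cases hx : x ∈ U
    · exact ⟨{x}, by simpa using hx, isCompact_singleton, by simpa [hU.measurableSet, hx] using hc⟩
    · simp [hU.measurableSet, hx] at hc

/-- The Dirac mass at `x` as a regular probability measure. -/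
noncomputable def RegularProbabilityMeasure.dirac {K : Type*} [TopologicalSpace K] [T1Space K]
    [MeasurableSpace K] [BorelSpace K] (x : K) : RegularProbabilityMeasure K :=
  ⟨⟨Measure.dirac x, inferInstance⟩, Measure.regular_dirac x⟩

theorem RegularProbabilityMeasure.integral_dirac {K : Type*} [TopologicalSpace K] [T1Space K]
    [MeasurableSpace K] [BorelSpace K] (x : K) (f : K →ᵇ ℝ) :
    ∫ y, f y ∂((RegularProbabilityMeasure.dirac x).1 : Measure K) = f x :=
  MeasureTheory.integral_dirac' _ _ f.continuous.stronglyMeasurable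

theorem integral_iterate_inducedHomeomorph {K : Type*} [TopologicalSpace K]
    [MeasurableSpace K] [BorelSpace K] (T : K ≃ₜ K) (k : ℕ) (μ : RegularProbabilityMeasure K)
    (f : K →ᵇ ℝ) :
    ∫ x, f x ∂(((inducedHomeomorph T)^[k] μ).1 : Measure K) =
      ∫ x, f (T^[k] x) ∂(μ.1 : Measure K) := by
  induction k generalizing μ with
  | zero => rfl
  | succ k ih =>
    rw [Function.iterate_succ_apply, ih]
    change ∫ x, f (T^[k] x) ∂(Measure.map T (μ.1 : Measure K)) = _
    rw [(Homeomorph.measurableEmbedding T).integral_map]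
    simp only [Function.iterate_succ_apply]

/-! ### From measures to points -/

theorem abs_sub_lt_of_mem_iteratedJoin {X I : Type*} {T : X → X} {𝒲 : Set (Set X)}
    {φ : X → I → ℝ} {s : Finset I} {η : ℝ}
    (h : ∀ U ∈ 𝒲, ∀ x ∈ U, ∀ y ∈ U, ∀ i ∈ s, |φ x i - φ y i| < η) {n : ℕ} {B : Set X}
    (hB : B ∈ iteratedJoin T 𝒲 n) {x y : X} (hx : x ∈ B) (hy : y ∈ B) (k : Fin n) {i : I}
    (hi : i ∈ s) : |φ (T^[k] x) i - φ (T^[k] y) i| < η := by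
  obtain ⟨A, hA, rfl⟩ := hB
  exact h _ (hA k) _ (Set.mem_iInter.1 hx k) _ (Set.mem_iInter.1 hy k) i hi

theorem topologicalEntropy_eq_zero_of_inducedHomeomorph {K : Type*} [TopologicalSpace K]
    [CompactSpace K] [T2Space K] [MeasurableSpace K] [BorelSpace K] (T : K ≃ₜ K)
    (h : topologicalEntropy
      (inducedHomeomorph T : RegularProbabilityMeasure K → RegularProbabilityMeasure K) = 0) :
    topologicalEntropy (T : K → K) = 0 := by
  rw [topologicalEntropy_eq_zero_iff] at h ⊢
  intro 𝒲 h𝒲 γ hγ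
  obtain ⟨s, η, hη, hball⟩ := exists_finset_ball_subset_of_isInducing
    (isInducing_eval_boundedContinuousFunction K) h𝒲
  obtain ⟨𝒱, h𝒱, hsmall⟩ := exists_isFiniteOpenCover_forall_abs_sub_lt
    (RegularProbabilityMeasure.isInducing_integral K).continuous s hη
  filter_upwards [h 𝒱 h𝒱 γ hγ] with n hn
  refine le_trans ?_ hn
  obtain ⟨F, hF, hFu, hFc⟩ := exists_minSubcover_iteratedJoin (inducedHomeomorph T) h𝒱 n
  -- A point is coded by a cell containing its Dirac mass.
  have hex : ∀ x : K, ∃ B : F, RegularProbabilityMeasure.dirac x ∈ B.1 := fun x => by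
    obtain ⟨B, hB, hxB⟩ : RegularProbabilityMeasure.dirac x ∈ ⋃₀ (F : Set (Set _)) :=
      hFu ▸ Set.mem_univ _
    exact ⟨⟨B, hB⟩, hxB⟩
  choose code hcode using hex
  rw [← hFc, ← Fintype.card_coe]
  refine Nat.cast_le.2 (minSubcoverCard_iteratedJoin_le_card hball n code ?_)
  intro x y hxy k f hf
  have hy := hcode y
  rw [hxy] at hy
  have key := abs_sub_lt_of_mem_iteratedJoin hsmall (hF (code x).2) hy (hcode x) k hf
  simp only [integral_iterate_inducedHomeomorph] at key
  have hval : ∀ z : K, ∫ w, f (T^[k] w) ∂((RegularProbabilityMeasure.dirac z).1 : Measure K) =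
      f (T^[k] z) := fun z =>
    RegularProbabilityMeasure.integral_dirac z
      (f.compContinuous ⟨T^[k], T.continuous.iterate k⟩)
  rwa [hval, hval] at key

/-! ### From points to measures -/

/-- A code for a probability measure `μ`: cells of a cover containing `r` sample points, together
with the (few) coordinates at which the sample averages are far from the means `∫ h j`, and the
approximate values of those means. -/
def IsSampleCode {K J : Type*} [MeasurableSpace K] (h : J → K → ℝ) (ε η : ℝ) {r : ℕ}
    {F : Finset (Set K)} {G : Finset ℤ} (μ : Measure K) (cell : Fin r → F) (c : J → Option G) :
    Prop :=
  ∃ x : Fin r → K, (∀ l, x l ∈ (cell l).1) ∧ ∀ j,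
    (c j = none → |(∑ l, h j (x l)) / r - ∫ y, h j y ∂μ| < ε) ∧
    ∀ z, c j = some z → ⌊(∫ y, h j y ∂μ) / η⌋ = z

/-- At an uncorrected coordinate there are three errors of at most `η / 4`: two from sampling, one
from the shared cells. At a corrected one, both means lie in the same half-open interval of length
`η`. -/
theorem IsSampleCode.abs_integral_sub_lt {K J : Type*} [MeasurableSpace K] {h : J → K → ℝ}
    {η : ℝ} (hη : 0 < η) {r : ℕ} {F : Finset (Set K)} {G : Finset ℤ} {μ ν : Measure K}
    {cell : Fin r → F} {c : J → Option G} (hr : 0 < r)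
    (hF : ∀ B ∈ F, ∀ x ∈ B, ∀ y ∈ B, ∀ j, |h j x - h j y| < η / 4)
    (hμ : IsSampleCode h (η / 4) η μ cell c) (hν : IsSampleCode h (η / 4) η ν cell c) (j : J) :
    |∫ y, h j y ∂ν - ∫ y, h j y ∂μ| < η := by
  obtain ⟨x, hx, hxc⟩ := hμ
  obtain ⟨y, hy, hyc⟩ := hν
  have hr' : (0 : ℝ) < r := by exact_mod_cast hr
  rcases hc : c j with _ | z
  · have h1 := abs_lt.1 ((hxc j).1 hc)
    have h2 := abs_lt.1 ((hyc j).1 hc)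
    have h3 : |(∑ l, h j (x l)) / r - (∑ l, h j (y l)) / r| ≤ η / 4 := by
      rw [← sub_div, ← Finset.sum_sub_distrib, abs_div, abs_of_pos hr', div_le_iff₀ hr']
      refine (Finset.abs_sum_le_sum_abs _ _).trans ?_
      calc ∑ l, |h j (x l) - h j (y l)| ≤ ∑ _l : Fin r, η / 4 :=
            Finset.sum_le_sum fun l _ => (hF _ (cell l).2 _ (hx l) _ (hy l) j).le
        _ = η / 4 * r := by simp [mul_comm]
    have h4 := abs_le.1 h3
    rw [abs_lt]
    constructor <;> linarith
  · have h1 := (hxc j).2 z hc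
    have h2 := (hyc j).2 z hc
    have h3 := Int.abs_sub_lt_one_of_floor_eq_floor (h2.trans h1.symm)
    rw [← sub_div, abs_div, abs_of_pos hη, div_lt_one hη] at h3
    exact h3

theorem exists_isSampleCode {K J : Type*} [MeasurableSpace K] [Fintype J] (μ : Measure K)
    [IsProbabilityMeasure μ] {h : J → K → ℝ} {M ε η : ℝ} (hε : 0 < ε) (hη : 0 < η)
    (hm : ∀ j, AEStronglyMeasurable (h j) μ) (hM : ∀ j x, |h j x| ≤ M) {r : ℕ} (hr : 0 < r)
    {F : Finset (Set K)} (hF : ⋃₀ (F : Set (Set K)) = Set.univ) :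
    ∃ (cell : Fin r → F) (c : J → Option (Finset.Icc ⌊-M / η⌋ ⌊M / η⌋)),
      (Nat.card {j // c j ≠ none} : ℝ) ≤ Fintype.card J * (M ^ 2 / (r * ε ^ 2)) ∧
      IsSampleCode h ε η μ cell c := by
  classical
  obtain ⟨x, hx⟩ := exists_sample_card_bad_le μ hε hm hM hr
  have hex : ∀ y : K, ∃ B : F, y ∈ B.1 := fun y => by
    obtain ⟨B, hB, hyB⟩ : y ∈ ⋃₀ (F : Set (Set _)) := hF ▸ Set.mem_univ _
    exact ⟨⟨B, hB⟩, hyB⟩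
  choose cell hcell using hex
  have hint : ∀ j, |∫ y, h j y ∂μ| ≤ M := fun j => by
    have := norm_integral_le_of_norm_le_const (μ := μ)
      (Filter.Eventually.of_forall fun y => (Real.norm_eq_abs _).trans_le (hM j y))
    simpa using this
  have hfloor : ∀ j, ⌊(∫ y, h j y ∂μ) / η⌋ ∈ Finset.Icc ⌊-M / η⌋ ⌊M / η⌋ := fun j => by
    obtain ⟨h1, h2⟩ := abs_le.1 (hint j)
    exact Finset.mem_Icc.2 ⟨Int.floor_mono (by gcongr), Int.floor_mono (by gcongr)⟩
  refine ⟨fun l => cell (x l), fun j => if ε ≤ |(∑ l, h j (x l)) / r - ∫ y, h j y ∂μ| then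
    some ⟨_, hfloor j⟩ else none, ?_, x, fun l => hcell _, fun j => ⟨fun hc => ?_, fun z hc => ?_⟩⟩
  · convert hx using 4
    simp
  · by_contra hlt
    dsimp only at hc
    rw [if_pos (not_lt.1 hlt)] at hc
    cases hc
  · dsimp only at hc
    split_ifs at hc
    cases hc
    rfl

theorem topologicalEntropy_inducedHomeomorph_eq_zero {K : Type*} [TopologicalSpace K]
    [CompactSpace K] [T2Space K] [MeasurableSpace K] [BorelSpace K] (T : K ≃ₜ K)
    (h : topologicalEntropy (T : K → K) = 0) :
    topologicalEntropy
      (inducedHomeomorph T : RegularProbabilityMeasure K → RegularProbabilityMeasure K) = 0 := by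
  classical
  rw [topologicalEntropy_eq_zero_iff] at h ⊢
  intro 𝒲 h𝒲 γ hγ
  obtain ⟨s, η, hη, hball⟩ := exists_finset_ball_subset_of_isInducing
    (RegularProbabilityMeasure.isInducing_integral K) h𝒲
  have hη4 : 0 < η / 4 := by positivity
  set M : ℝ := ∑ f ∈ s, ‖f‖ with hM
  have hsM : ∀ f ∈ s, ∀ x, |f x| ≤ M := fun f hf x =>
    (f.norm_coe_le_norm x).trans (Finset.single_le_sum (fun g _ => norm_nonneg g) hf)
  set G : Finset ℤ := Finset.Icc ⌊-M / η⌋ ⌊M / η⌋ with hG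
  -- The rate `γ` is split in three. First `τ` makes the second term of the Chernoff bound small;
  -- then `r`, depending on `τ`, makes the first small. Neither depends on `n`.
  obtain ⟨τ, hτ, hτ0⟩ : ∃ τ : ℝ, s.card * (G.card * Real.exp (-τ)) ≤ γ / 3 ∧ 0 ≤ τ := by
    have hlim : Filter.Tendsto (fun τ : ℝ => s.card * (G.card * Real.exp (-τ))) Filter.atTop
        (𝓝 (s.card * (G.card * 0))) :=
      (Real.tendsto_exp_neg_atTop_nhds_zero.const_mul _).const_mul _
    have hev := hlim.eventually (ge_mem_nhds (show (s.card : ℝ) * (G.card * 0) < γ / 3 by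
      simpa using hγ))
    exact (hev.and (Filter.eventually_ge_atTop 0)).exists
  obtain ⟨r, hr⟩ := exists_nat_gt (τ * s.card * M ^ 2 / (η / 4) ^ 2 / (γ / 3))
  have hr' : (0 : ℝ) < r := lt_of_le_of_lt (by positivity) hr
  have hr0 : 0 < r := by exact_mod_cast hr'
  have hδ : τ * (s.card * (M ^ 2 / (r * (η / 4) ^ 2))) ≤ γ / 3 := by
    rw [div_lt_iff₀ (by positivity)] at hr
    calc τ * (s.card * (M ^ 2 / (r * (η / 4) ^ 2)))
        = τ * s.card * M ^ 2 / (η / 4) ^ 2 / r := by field_simp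
      _ ≤ γ / 3 := by
        rw [div_le_iff₀ hr']
        linarith
  obtain ⟨𝒱, h𝒱, hsmall⟩ := exists_isFiniteOpenCover_forall_abs_sub_lt
    (isInducing_eval_boundedContinuousFunction K).continuous s hη4
  -- The last third: raised to the power `r`, this bound becomes `exp (γ / 3 * n)`.
  filter_upwards [h 𝒱 h𝒱 (γ / (3 * r)) (by positivity)] with n hn
  obtain ⟨F, hF, hFu, hFc⟩ := exists_minSubcover_iteratedJoin T h𝒱 n
  let H : Fin n × s → K → ℝ := fun j x => j.2.1 (T^[j.1] x)
  have hHm : ∀ (j) (μ : Measure K), AEStronglyMeasurable (H j) μ := fun j μ =>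
    (j.2.1.continuous.comp (T.continuous.iterate j.1)).aestronglyMeasurable
  have hHM : ∀ j x, |H j x| ≤ M := fun j x => hsM _ j.2.2 _
  have hHF : ∀ B ∈ F, ∀ x ∈ B, ∀ y ∈ B, ∀ j, |H j x - H j y| < η / 4 := fun B hB x hx y hy j =>
    abs_sub_lt_of_mem_iteratedJoin hsmall (hF hB) hx hy j.1 j.2.2
  set D : ℝ := Fintype.card (Fin n × s) * (M ^ 2 / (r * (η / 4) ^ 2)) with hD
  have hex : ∀ μ : RegularProbabilityMeasure K,
      ∃ a : (Fin r → F) × {c : Fin n × s → Option G // (Nat.card {j // c j ≠ none} : ℝ) ≤ D},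
        IsSampleCode H (η / 4) η (μ.1 : Measure K) a.1 a.2.1 := fun μ => by
    obtain ⟨cell, c, hc, hcode⟩ := exists_isSampleCode (μ.1 : Measure K) hη4 hη
      (fun j => hHm j _) hHM hr0 hFu
    exact ⟨(cell, ⟨c, hc⟩), hcode⟩
  choose code hcode using hex
  have hle := minSubcoverCard_iteratedJoin_le_card (T := inducedHomeomorph T) hball n code
    fun μ ν hμν k f hf => by
      have hν := hcode ν
      rw [hμν] at hν
      simp only [integral_iterate_inducedHomeomorph]
      exact (hcode μ).abs_integral_sub_lt hη hr0 hHF hν (k, ⟨f, hf⟩)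
  refine (Nat.cast_le.2 hle).trans ?_
  have hcount := card_option_valued_le (J := Fin n × s) (G := G) τ D hτ0
  rw [Nat.card_eq_fintype_card] at hcount
  rw [Fintype.card_prod, Fintype.card_fun, Fintype.card_fin, Fintype.card_coe, hFc]
  push_cast
  refine (mul_le_mul (pow_le_pow_left₀ (Nat.cast_nonneg _) hn r) hcount (Nat.cast_nonneg _)
    (by positivity)).trans ?_
  rw [← Real.exp_nat_mul, ← Real.exp_add]
  refine Real.exp_le_exp.2 ?_
  simp only [hD, Fintype.card_prod, Fintype.card_fin, Fintype.card_coe, Nat.cast_mul]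
  have h1 : (r : ℝ) * (γ / (3 * r) * n) = γ / 3 * n := by field_simp
  have hn0 : (0 : ℝ) ≤ n := Nat.cast_nonneg n
  have h2 := mul_le_mul_of_nonneg_left hδ hn0
  have h3 := mul_le_mul_of_nonneg_left hτ hn0
  rw [h1]
  linarith

theorem corollary3 {K : Type*} [TopologicalSpace K] [CompactSpace K] [T2Space K]
    [MeasurableSpace K] [BorelSpace K] (T : K ≃ₜ K) :
    topologicalEntropy (T : K → K) = 0 ↔
      topologicalEntropy
        (inducedHomeomorph T : RegularProbabilityMeasure K → RegularProbabilityMeasure K) = 0 :=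
  ⟨topologicalEntropy_inducedHomeomorph_eq_zero T,
    topologicalEntropy_eq_zero_of_inducedHomeomorph T⟩
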